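/- Let $G=(V,E)$ be a finite directed graph with influence weights $b(u,v)\in[0,1]$ and meeting probabilities $m(u,v)\in[0,1]$ on its edges, both set to $0$ when $(u,v)\notin E$, such that $\sum_{u} b(u,v)\le 1$ for every $v\in V$. This is an instance of the Linear Threshold model with meeting events (LT-M). Given a seed set $S\subseteq V$, the diffusion runs as follows. Each node $v$ draws a threshold $\theta_v$ uniformly from $[0,1]$, and the nodes of $S$ are activated at step $0$. At each step $t\ge 1$, active nodes remain active, and each node $u$ that was active by step $t-1$ meets each of its out-neighbours $v$ that was not active by step $t-1$ with probability $m(u,v)$; all thresholds and all meetings are independent. From the first step at which $u$ meets $v$ after $u$'s activation, $u$ is an effective in-neighbour of $v$. An inactive node $v$ becomes active at step $t$ if $\sum_{u} b(u,v)\ge\theta_v$, the sum being over the effective in-neighbours $u$ of $v$ at step $t$ (including those that became effective at step $t$). Let $\sigma_\tau(S)$ be the expected number of nodes that are active by the end of step $\tau$ (seeds included). Theorem. For every instance of LT-M and every deadline $\tau\ge 1$, the function $\sigma_\tau\colon 2^V\to\mathbb{R}$ is (1) monotone: $\sigma_\tau(S)\le\sigma_\tau(T)$ whenever $S\subseteq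 T\subseteq V$; and (2) submodular: $\sigma_\tau(S\cup\{w\})-\sigma_\tau(S)\ge\sigma_\tau(T\cup\{w\})-\sigma_\tau(T)$ whenever $S\subseteq T\subseteq V$ and $w\in V\setminus T$. Consequently, (3) for every $k\le|V|$, the greedy algorithm, which starts from $\emptyset$ and $k$ times adds to the current set $S$ a node $u\in V\setminus S$ of largest marginal gain $\sigma_\tau(S\cup\{u\})-\sigma_\tau(S)$, can be carried out, and with any rule for breaking ties it outputs a set $S$ of exactly $k$ nodes such that $\sigma_\tau(S)\ge(1-1/e)\,\sigma_\tau(T)$ for every $T\subseteq V$ with $|T|\le k$. -/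

import Mathlib

open MeasureTheory ProbabilityTheory

/-- An instance of the Linear Threshold model with meeting events (LT-M) on the node set `V`:
a directed graph with influence weights `b u v` and meeting probabilities `m u v` in `[0, 1]`,
both zero off the edge set, such that the weights into each node add up to at most one. -/
structure LTMInstance (V : Type*) [Fintype V] where
  graph : Digraph V
  b : V → V → unitInterval
  m : V → V → unitInterval
  b_eq_zero : ∀ u v, ¬ graph.Adj u v → b u v = 0
  m_eq_zero : ∀ u v, ¬ graph.Adj u v → m u v = 0
  sum_b_le_one : ∀ v, ∑ u, (b u v : ℝ) ≤ 1

/-- The state of the diffusion at the end of a step. -/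
structure LTMState (V : Type*) where
  /-- The nodes that are active by the end of the current step. -/
  active : Finset V
  /-- The effective in-neighbours of each node by the end of the current step. -/
  effective : V → Finset V

/-- The sample space of the diffusion: a threshold in `[0, 1]` for each node and, for each step `t`
and each ordered pair `(u, v)`, the outcome at `(t, u, v)` of a coin that decides whether `u`
meets `v` at step `t`. -/
abbrev LTMOutcome (V : Type*) : Type _ := (V → unitInterval) × (ℕ × V × V → Bool)

namespace LTMInstance

variable {V : Type*} [Fintype V]

/-- The law of the random outcomes: the thresholds are uniform on `[0, 1]`, the coin of `u` and `v`
at each step shows `true` with probability `m u v`, and all of these are independent. -/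
noncomputable def outcomeMeasure (I : LTMInstance V) : Measure (LTMOutcome V) :=
  (Measure.pi fun _ : V => (volume : Measure unitInterval)).prod
    (Measure.infinitePi fun e : ℕ × V × V => bernoulliMeasure true false (I.m e.2.1 e.2.2))

variable [DecidableEq V]

open scoped Classical in
/-- One step of the diffusion. Each active node `u` meets its currently inactive out-neighbours `v`
as decided by the coins of this step, and `u` is then an effective in-neighbour of `v` for good.
A node becomes active if its total effective weight is at least its threshold; active nodes stay
active. -/
noncomputable def step (I : LTMInstance V) (θ : V → unitInterval) (coin : V → V → Bool)
    (s : LTMState V) : LTMState V :=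
  let eff : V → Finset V := fun v =>
    s.effective v ∪
      Finset.univ.filter (fun u =>
        I.graph.Adj u v ∧ u ∈ s.active ∧ v ∉ s.active ∧ coin u v = true)
  { active := s.active ∪
      Finset.univ.filter (fun v => (θ v : ℝ) ≤ ∑ u ∈ eff v, (I.b u v : ℝ))
    effective := eff }

/-- The state of the diffusion with seed set `S` and outcomes `ω` at the end of step `t`. -/
noncomputable def state (I : LTMInstance V) (S : Finset V) (ω : LTMOutcome V) : ℕ → LTMState V
  | 0 => { active := S, effective := fun _ => ∅ }
  | t + 1 => I.step ω.1 (fun u v => ω.2 (t + 1, u, v)) (I.state S ω t)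

/-- The influence function `σ_τ(S)`: the expected number of nodes that are active by step `τ` when
`S` is the seed set. -/
noncomputable def influence (I : LTMInstance V) (τ : ℕ) (S : Finset V) : ℝ :=
  ∫ ω, ((I.state S ω τ).active.card : ℝ) ∂I.outcomeMeasure

instance (I : LTMInstance V) : IsProbabilityMeasure I.outcomeMeasure := by
  unfold outcomeMeasure; infer_instance

theorem measurableSet_state (I : LTMInstance V) (S : Finset V) (t : ℕ) :
    (∀ v, MeasurableSet {ω : LTMOutcome V | v ∈ (I.state S ω t).active}) ∧
      ∀ u v, MeasurableSet {ω : LTMOutcome V | u ∈ (I.state S ω t).effective v} := by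
  induction t with
  | zero => simp [state]
  | succ t ih =>
    obtain ⟨ha, he⟩ := ih
    have hcoin : ∀ u v, MeasurableSet {ω : LTMOutcome V | ω.2 (t + 1, u, v) = true} := by
      intro u v
      have h : Measurable fun ω : LTMOutcome V => ω.2 (t + 1, u, v) := by fun_prop
      exact h (measurableSet_singleton true)
    have he' : ∀ u v,
        MeasurableSet {ω : LTMOutcome V | u ∈ (I.state S ω (t + 1)).effective v} := by
      intro u v
      have h := (he u v).union ((MeasurableSet.const (I.graph.Adj u v)).inter
        ((ha u).inter ((ha v).compl.inter (hcoin u v))))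
      convert h using 1
      ext ω
      simp [state, step]
    refine ⟨fun v => ?_, he'⟩
    have hθ : Measurable fun ω : LTMOutcome V => (ω.1 v : ℝ) := by fun_prop
    have hs : Measurable fun ω : LTMOutcome V =>
        ∑ u ∈ (I.state S ω (t + 1)).effective v, (I.b u v : ℝ) := by
      have h : Measurable fun ω : LTMOutcome V =>
          ∑ u, Set.indicator {ω : LTMOutcome V | u ∈ (I.state S ω (t + 1)).effective v}
            (fun _ => (I.b u v : ℝ)) ω :=
        Finset.measurable_sum _ fun u _ => measurable_const.indicator (he' u v)
      convert h using 2 with ω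
      simp [Set.indicator_apply]
    have h := (ha v).union (measurableSet_le hθ hs)
    convert h using 1
    ext ω
    simp [state, step]

/-- The number of active nodes is an integrable random variable, so that its expectation is a
genuine one. -/
theorem integrable_card_active (I : LTMInstance V) (τ : ℕ) (S : Finset V) :
    Integrable (fun ω => ((I.state S ω τ).active.card : ℝ)) I.outcomeMeasure := by
  have h : Measurable fun ω : LTMOutcome V => ((I.state S ω τ).active.card : ℝ) := by
    have h : Measurable fun ω : LTMOutcome V =>
        ∑ v, Set.indicator {ω : LTMOutcome V | v ∈ (I.state S ω τ).active}
          (fun _ => (1 : ℝ)) ω :=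
      Finset.measurable_sum _ fun v _ =>
        measurable_const.indicator ((I.measurableSet_state S τ).1 v)
    convert h using 2 with ω
    simp [Set.indicator_apply]
  refine Integrable.of_bound h.aestronglyMeasurable (Fintype.card V : ℝ) ?_
  refine Filter.Eventually.of_forall fun ω => ?_
  simpa using Finset.card_le_univ _

end LTMInstance

/-- A set function is submodular if marginal gains do not increase as the set grows. -/
def IsSubmodular {V : Type*} [DecidableEq V] (f : Finset V → ℝ) : Prop :=
  ∀ S T : Finset V, S ⊆ T → ∀ w, w ∉ T → f (insert w T) - f T ≤ f (insert w S) - f S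

/-- `GreedyOutput f k S` says that `S` is a possible output, for some way of breaking ties, of the
greedy algorithm that starts from the empty set and `k` times adds a new element of largest
marginal gain. -/
inductive GreedyOutput {V : Type*} [DecidableEq V] (f : Finset V → ℝ) : ℕ → Finset V → Prop
  | zero : GreedyOutput f 0 ∅
  | succ {k : ℕ} {S : Finset V} {u : V} (hS : GreedyOutput f k S) (hu : u ∉ S)
      (hmax : ∀ v, v ∉ S → f (insert v S) - f S ≤ f (insert u S) - f S) :
      GreedyOutput f (k + 1) (insert u S)

/-! Fix all meeting coins and average over the thresholds only. The spread then has the same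
expectation if each node `v` instead chooses at most one in-neighbour, `u` with probability `b u v`,
and becomes active once its choice is effective (`lintegral_threshold_eq_live`).

The laws are exchanged one node at a time (`lintegral_pi_congr`). With all other rules fixed, the
rule of `v` matters only through its answers on the effective sets that `v` would have if it never
became active (`ruleState_update_congr`). These form an increasing chain, and along a chain the law
of the answers is determined by the probability of accepting each single set `X`
(`lintegral_upperSet_congr`). Under both laws this probability is the total weight of `X`.

With choices and coins fixed, the active set of `S ∪ T` is the union of those of `S` and `T`
(`ruleState_union`), so its size is a coverage function, hence monotone and submodular. Averaging
over choices and coins preserves both properties, and the greedy bound is the classical argument of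
Nemhauser, Wolsey and Fisher. -/

/-! ### The greedy algorithm -/

section Greedy

variable {V : Type*} [DecidableEq V] {f : Finset V → ℝ}

theorem GreedyOutput.card_eq {k : ℕ} {S : Finset V} (h : GreedyOutput f k S) : S.card = k := by
  induction h with
  | zero => rfl
  | succ hS hu hmax ih => rw [Finset.card_insert_of_notMem hu, ih]

theorem GreedyOutput.exists [Fintype V] (f : Finset V → ℝ) {k : ℕ} (hk : k ≤ Fintype.card V) :
    ∃ S, GreedyOutput f k S := by
  induction k with
  | zero => exact ⟨∅, .zero⟩
  | succ k ih =>
    obtain ⟨S, hS⟩ := ih (by omega)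
    have hne : (Sᶜ).Nonempty := by
      rw [← Finset.card_pos, Finset.card_compl, hS.card_eq]
      omega
    obtain ⟨u, hu, hmax⟩ := Finset.exists_max_image Sᶜ (fun v => f (insert v S) - f S) hne
    exact ⟨insert u S, hS.succ (Finset.mem_compl.1 hu) fun v hv =>
      hmax v (Finset.mem_compl.2 hv)⟩

/-- The gain of adding a whole set is at most the sum of the gains of its elements. -/
theorem IsSubmodular.union_sub_le_sum (hs : IsSubmodular f) (hm : Monotone f)
    (S T : Finset V) : f (S ∪ T) - f S ≤ ∑ v ∈ T, (f (insert v S) - f S) := by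
  induction T using Finset.induction_on with
  | empty => simp
  | insert v T hv ih =>
    rw [Finset.sum_insert hv, Finset.union_insert]
    have h : f (insert v (S ∪ T)) - f (S ∪ T) ≤ f (insert v S) - f S := by
      by_cases hvS : v ∈ S ∪ T
      · rw [Finset.insert_eq_self.2 hvS, sub_self]
        exact sub_nonneg.2 (hm (Finset.subset_insert v S))
      · exact hs S (S ∪ T) Finset.subset_union_left v hvS
    linarith

/-- By submodularity the best available gain is at least `1 / K` of the remaining gap, so each step
shrinks the gap by the factor `1 - 1 / K`. The budget `K` is kept apart from the step count `i`,
which is what the induction runs on. -/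
theorem GreedyOutput.gap_le (hs : IsSubmodular f) (hm : Monotone f) (h0 : 0 ≤ f ∅)
    {K : ℕ} (hK : 1 ≤ K) {T : Finset V} (hT : T.card ≤ K) {i : ℕ} {S : Finset V}
    (h : GreedyOutput f i S) : f T - f S ≤ (1 - 1 / (K : ℝ)) ^ i * f T := by
  have hK' : (1 : ℝ) ≤ K := by exact_mod_cast hK
  have hq : 0 ≤ 1 - 1 / (K : ℝ) := by
    rw [sub_nonneg, div_le_one (by linarith)]
    exact hK'
  induction h with
  | zero => simpa using h0
  | @succ i S u hS hu hmax ih =>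
    set δ := f (insert u S) - f S with hδ
    have hδ0 : 0 ≤ δ := sub_nonneg.2 (hm (Finset.subset_insert u S))
    have hle : ∀ v ∈ T, f (insert v S) - f S ≤ δ := by
      intro v _
      by_cases hv : v ∈ S
      · rw [Finset.insert_eq_self.2 hv, sub_self]
        exact hδ0
      · exact hmax v hv
    have h1 : f T - f S ≤ K * δ := by
      calc f T - f S ≤ f (S ∪ T) - f S := by
            linarith [hm (Finset.subset_union_right : T ⊆ S ∪ T)]
        _ ≤ ∑ v ∈ T, (f (insert v S) - f S) := hs.union_sub_le_sum hm S T
        _ ≤ T.card * δ := by simpa using Finset.sum_le_card_nsmul T _ δ hle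
        _ ≤ K * δ := by gcongr
    have h2 : (f T - f S) / K ≤ δ := by
      rw [div_le_iff₀ (by linarith)]
      linarith
    calc f T - f (insert u S) = (f T - f S) - δ := by rw [hδ]; ring
      _ ≤ (1 - 1 / (K : ℝ)) * (f T - f S) := by
          have : (1 - 1 / (K : ℝ)) * (f T - f S) = (f T - f S) - (f T - f S) / K := by ring
          linarith
      _ ≤ (1 - 1 / (K : ℝ)) * ((1 - 1 / (K : ℝ)) ^ i * f T) :=
          mul_le_mul_of_nonneg_left ih hq
      _ = _ := by ring

/-- The greedy guarantee for nonnegative monotone submodular functions. -/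
theorem GreedyOutput.guarantee (hs : IsSubmodular f) (hm : Monotone f) (h0 : 0 ≤ f ∅)
    {k : ℕ} {S T : Finset V} (h : GreedyOutput f k S) (hT : T.card ≤ k) :
    (1 - 1 / Real.exp 1) * f T ≤ f S := by
  have hfT : 0 ≤ f T := h0.trans (hm (Finset.empty_subset T))
  rcases Nat.eq_zero_or_pos k with rfl | hk
  · have hT0 : T = ∅ := by simpa using hT
    have hST : f T ≤ f S := hm (hT0 ▸ Finset.empty_subset S)
    have : 0 ≤ 1 / Real.exp 1 * f T := by positivity
    linarith
  · have h1 := h.gap_le hs hm h0 hk hT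
    have h2 : (1 - 1 / (k : ℝ)) ^ k ≤ 1 / Real.exp 1 := by
      have := Real.one_sub_div_pow_le_exp_neg (n := k) (t := 1) (by exact_mod_cast hk)
      rwa [Real.exp_neg, ← one_div] at this
    have h3 := mul_le_mul_of_nonneg_right h2 hfT
    linarith

end Greedy

/-! ### Replacing the factors of a product measure one at a time -/

theorem MeasureTheory.lintegral_pi_congr {ι α : Type*} [Fintype ι] [DecidableEq ι]
    [MeasurableSpace α] (μ ν : ι → Measure α) [∀ i, IsProbabilityMeasure (μ i)]
    [∀ i, IsProbabilityMeasure (ν i)]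
    {g : (ι → α) → ENNReal} (hg : Measurable g)
    (h : ∀ i x, ∫⁻ y, g (Function.update x i y) ∂μ i = ∫⁻ y, g (Function.update x i y) ∂ν i) :
    ∫⁻ x, g x ∂Measure.pi μ = ∫⁻ x, g x ∂Measure.pi ν := by
  have key : ∀ s : Finset ι, ∀ g : (ι → α) → ENNReal, Measurable g →
      (∀ i x, ∫⁻ y, g (Function.update x i y) ∂μ i = ∫⁻ y, g (Function.update x i y) ∂ν i) →
      lmarginal μ s g = lmarginal ν s g := by
    intro s
    induction s using Finset.induction_on with
    | empty => intro g _ _; simp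
    | insert i s hi ih =>
      intro g hg h
      rw [lmarginal_insert' g hg hi, lmarginal_insert' g hg hi]
      simp_rw [h]
      have hupd : ∀ j : ι, Measurable fun p : (ι → α) × α => Function.update p.1 j p.2 := by
        intro j
        exact measurable_update'
      have hgi : Measurable fun x => ∫⁻ y, g (Function.update x i y) ∂ν i :=
        (hg.comp (hupd i)).lintegral_prod_right'
      refine ih _ hgi fun j x => ?_
      -- After coordinate `i` is integrated out, the function no longer depends on it, so for `j =
      -- i` both sides integrate a constant against probability measures. For `j ≠ i`, Tonelli
      -- reduces the claim to the hypothesis at `j`.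
      by_cases hij : i = j
      · subst hij
        simp
      have hm : Measurable (Function.uncurry fun z y : α =>
          g (Function.update (Function.update x j z) i y)) :=
        hg.comp ((hupd i).comp ((measurable_update x).comp measurable_fst |>.prodMk measurable_snd))
      rw [lintegral_lintegral_swap hm.aemeasurable, lintegral_lintegral_swap hm.aemeasurable]
      refine lintegral_congr fun y => ?_
      simp_rw [fun z => Function.update_comm (Ne.symm hij) z y x]
      exact h j _
  rcases isEmpty_or_nonempty (ι → α) with hE | ⟨⟨x⟩⟩
  · simp [lintegral_of_isEmpty]
  · rw [lintegral_eq_lmarginal_univ x, lintegral_eq_lmarginal_univ x, key _ g hg h]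

/-- Two laws of a random upper set that agree on the events that the upper set contains a given
point give the same expectation to every function that only depends on which members of an
increasing finite chain belong to the upper set. -/
theorem lintegral_upperSet_congr {α : Type*} [Preorder α] [MeasurableSpace (UpperSet α)]
    [DiscreteMeasurableSpace (UpperSet α)] (μ ν : Measure (UpperSet α)) [IsProbabilityMeasure μ]
    [IsProbabilityMeasure ν] (h : ∀ a, μ {x | a ∈ x} = ν {x | a ∈ x}) {X : ℕ → α}
    (hX : Monotone X) (n : ℕ) (g : UpperSet α → ENNReal)
    (hg : ∀ x y : UpperSet α, (∀ t ≤ n, X t ∈ x ↔ X t ∈ y) → g x = g y) :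
    ∫⁻ x, g x ∂μ = ∫⁻ x, g x ∂ν := by
  classical
  -- The index at which the chain enters `x`, or `n + 1` if it does not enter by time `n`. It
  -- encodes all the answers, and its distribution function is given by `h`.
  let N : UpperSet α → ℕ := fun x => ((Finset.range (n + 1)).filter fun t => X t ∉ x).card
  have hN : ∀ x, ∀ t ≤ n, (N x ≤ t ↔ X t ∈ x) := by
    intro x t ht
    constructor
    · intro hle
      by_contra hx
      have hsub : Finset.range (t + 1) ⊆ (Finset.range (n + 1)).filter fun t => X t ∉ x := by
        intro s hs
        rw [Finset.mem_range] at hs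
        rw [Finset.mem_filter, Finset.mem_range]
        exact ⟨by omega, fun hxs => hx (x.upper (hX (by omega)) hxs)⟩
      have := Finset.card_le_card hsub
      rw [Finset.card_range] at this
      exact absurd (this.trans hle) (by omega)
    · intro hx
      have hsub : ((Finset.range (n + 1)).filter fun t => X t ∉ x) ⊆ Finset.range t := by
        intro s hs
        rw [Finset.mem_filter] at hs
        rw [Finset.mem_range]
        by_contra hst
        exact hs.2 (x.upper (hX (by omega)) hx)
      simpa using Finset.card_le_card hsub
  have hNn : ∀ x, N x ≤ n + 1 := fun x => by
    simpa using Finset.card_filter_le (Finset.range (n + 1)) fun t => X t ∉ x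
  have hfac : g.FactorsThrough N := by
    intro x y hxy
    refine hg x y fun t ht => ?_
    rw [← hN x t ht, ← hN y t ht, hxy]
  have hmeas : Measurable N := .of_discrete
  have hmap : μ.map N = ν.map N := by
    have := Measure.isProbabilityMeasure_map (μ := μ) hmeas.aemeasurable
    refine Measure.ext_of_Iic _ _ fun t => ?_
    rw [Measure.map_apply hmeas measurableSet_Iic, Measure.map_apply hmeas measurableSet_Iic]
    by_cases ht : t ≤ n
    · have : N ⁻¹' Set.Iic t = {x | X t ∈ x} := Set.ext fun x => hN x t ht
      rw [this, h]
    · have : N ⁻¹' Set.Iic t = Set.univ :=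
        Set.eq_univ_of_forall fun x => (hNn x).trans (by omega)
      rw [this, measure_univ, measure_univ]
  have hgN : g = fun x => Function.extend N g 0 (N x) :=
    funext fun x => (hfac.extend_apply 0 x).symm
  rw [hgN, ← lintegral_map (f := Function.extend N g 0) .of_discrete hmeas, hmap,
    lintegral_map (f := Function.extend N g 0) .of_discrete hmeas]

/-! ### Diffusions with given meetings and activation rules -/

section RuleState

variable {V : Type*} [Fintype V] [DecidableEq V]

open scoped Classical in
/-- The diffusion in which `c t u v` says whether `u` would meet `v` at step `t`, and in which `v`
becomes active as soon as its set of effective in-neighbours belongs to `r v`. Here meetings count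
whether or not `v` is already active. -/
noncomputable def ruleState (c : ℕ → V → V → Prop) (r : V → UpperSet (Finset V)) (S : Finset V) :
    ℕ → LTMState V
  | 0 => { active := S, effective := fun _ => ∅ }
  | t + 1 =>
    let s := ruleState c r S t
    let eff : V → Finset V := fun v =>
      s.effective v ∪ Finset.univ.filter fun u => u ∈ s.active ∧ c (t + 1) u v
    { active := s.active ∪ Finset.univ.filter fun v => eff v ∈ r v
      effective := eff }

variable (c : ℕ → V → V → Prop) (r : V → UpperSet (Finset V)) (S T : Finset V)

open scoped Classical in
theorem ruleState_effective_succ (t : ℕ) (v : V) :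
    (ruleState c r S (t + 1)).effective v = (ruleState c r S t).effective v ∪
      Finset.univ.filter fun u => u ∈ (ruleState c r S t).active ∧ c (t + 1) u v := rfl

theorem mem_ruleState_effective_succ {t : ℕ} {u v : V} :
    u ∈ (ruleState c r S (t + 1)).effective v ↔ u ∈ (ruleState c r S t).effective v ∨
      u ∈ (ruleState c r S t).active ∧ c (t + 1) u v := by
  rw [ruleState_effective_succ]
  simp

theorem mem_ruleState_active_succ {t : ℕ} {v : V} :
    v ∈ (ruleState c r S (t + 1)).active ↔ v ∈ (ruleState c r S t).active ∨
      (ruleState c r S (t + 1)).effective v ∈ r v := by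
  rw [ruleState_effective_succ]
  simp [ruleState]

theorem monotone_ruleState_effective (v : V) :
    Monotone fun t => (ruleState c r S t).effective v :=
  monotone_nat_of_le_succ fun _ _ hu => (mem_ruleState_effective_succ c r S).2 (.inl hu)

theorem LTMState.eq_of_fields {V : Type*} {s t : LTMState V} (h : s.active = t.active)
    (h' : s.effective = t.effective) : s = t := by
  cases s
  cases t
  simp_all

/-- As long as `v` is not active, the diffusion runs as if `v` could never become active. -/
theorem ruleState_update_eq_of_notMem (v : V) (x : UpperSet (Finset V)) {t : ℕ}
    (h : v ∉ (ruleState c (Function.update r v x) S t).active) :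
    ruleState c (Function.update r v x) S t = ruleState c (Function.update r v ⊤) S t := by
  induction t with
  | zero => rfl
  | succ t ih =>
    rw [mem_ruleState_active_succ, not_or] at h
    have ih := ih h.1
    have heff : (ruleState c (Function.update r v x) S (t + 1)).effective =
        (ruleState c (Function.update r v ⊤) S (t + 1)).effective := by
      ext w u
      rw [mem_ruleState_effective_succ, mem_ruleState_effective_succ, ih]
    refine LTMState.eq_of_fields (Finset.ext fun w => ?_) heff
    rw [mem_ruleState_active_succ, mem_ruleState_active_succ, heff, ih]
    rw [ih, heff] at h
    by_cases hw : w = v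
    · subst hw
      -- `UpperSet` is ordered by reverse inclusion, so `⊤` is the empty upper set: the rule that
      -- never activates.
      simp [h.1] at h ⊢
      exact h
    · simp [hw]

/-- The rule of `v` influences the diffusion only through the question which of the sets of
effective in-neighbours that `v` has while inactive belong to it. -/
theorem ruleState_update_congr (v : V) (x y : UpperSet (Finset V)) {n : ℕ}
    (h : ∀ t ≤ n, (ruleState c (Function.update r v ⊤) S t).effective v ∈ x ↔
      (ruleState c (Function.update r v ⊤) S t).effective v ∈ y) :
    ruleState c (Function.update r v x) S n = ruleState c (Function.update r v y) S n := by
  induction n with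
  | zero => rfl
  | succ t ih =>
    have ih := ih fun s hs => h s (by omega)
    have heff : (ruleState c (Function.update r v x) S (t + 1)).effective =
        (ruleState c (Function.update r v y) S (t + 1)).effective := by
      ext w u
      rw [mem_ruleState_effective_succ, mem_ruleState_effective_succ, ih]
    refine LTMState.eq_of_fields (Finset.ext fun w => ?_) heff
    rw [mem_ruleState_active_succ, mem_ruleState_active_succ, ← heff, ← ih]
    by_cases hw : w = v
    · subst hw
      by_cases ha : w ∈ (ruleState c (Function.update r w x) S t).active
      · simp [ha]
      · have hnever : (ruleState c (Function.update r w x) S (t + 1)).effective =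
            (ruleState c (Function.update r w ⊤) S (t + 1)).effective := by
          ext w' u
          rw [mem_ruleState_effective_succ, mem_ruleState_effective_succ,
            ruleState_update_eq_of_notMem c r S w x ha]
        rw [hnever]
        simpa [ha] using h (t + 1) le_rfl
    · simp [hw]

/-- If every rule turns unions into disjunctions, then so does the diffusion. -/
theorem ruleState_union
    (hr : ∀ v (X Y : Finset V), X ∪ Y ∈ r v ↔ X ∈ r v ∨ Y ∈ r v) (t : ℕ) :
    (ruleState c r (S ∪ T) t).active =
        (ruleState c r S t).active ∪ (ruleState c r T t).active ∧
      ∀ v, (ruleState c r (S ∪ T) t).effective v =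
        (ruleState c r S t).effective v ∪ (ruleState c r T t).effective v := by
  induction t with
  | zero => simp [ruleState]
  | succ t ih =>
    obtain ⟨iha, ihe⟩ := ih
    have he : ∀ v, (ruleState c r (S ∪ T) (t + 1)).effective v =
        (ruleState c r S (t + 1)).effective v ∪ (ruleState c r T (t + 1)).effective v := by
      intro v
      ext u
      rw [Finset.mem_union]
      simp only [mem_ruleState_effective_succ, iha, ihe, Finset.mem_union]
      tauto
    refine ⟨Finset.ext fun v => ?_, he⟩
    rw [Finset.mem_union]
    simp only [mem_ruleState_active_succ, iha, he, hr, Finset.mem_union]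
    tauto

end RuleState

/-- The gain of `w` at `S` is the size of `F {w} \ F S`, which can only shrink as `S` grows. -/
theorem Finset.card_submodular_of_union {V : Type*} [DecidableEq V]
    {F : Finset V → Finset V} (hF : ∀ S T, F (S ∪ T) = F S ∪ F T) :
    Monotone (fun S => ((F S).card : ℝ)) ∧ IsSubmodular (fun S => ((F S).card : ℝ)) := by
  have hmono : ∀ S T, S ⊆ T → F S ⊆ F T := fun S T h => by
    rw [← Finset.union_eq_right.2 h, hF]
    exact Finset.subset_union_left
  refine ⟨fun S T h => Nat.cast_le.2 (Finset.card_le_card (hmono S T h)), ?_⟩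
  have hgain : ∀ S w, ((F (insert w S)).card : ℝ) - (F S).card = (F {w} \ F S).card := by
    intro S w
    rw [Finset.insert_eq, hF, ← Finset.card_sdiff_add_card, Nat.cast_add, add_sub_cancel_right]
  intro S T h w _
  simp only [hgain]
  exact Nat.cast_le.2 (Finset.card_le_card (Finset.sdiff_subset_sdiff subset_rfl (hmono S T h)))

/-! ### Threshold rules and live-edge rules -/

section Rules

variable {V : Type*}

instance UpperSet.instMeasurableSpace (α : Type*) [LE α] : MeasurableSpace (UpperSet α) := ⊤

instance UpperSet.instDiscreteMeasurableSpace (α : Type*) [LE α] :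
    DiscreteMeasurableSpace (UpperSet α) := ⟨fun _ => trivial⟩

instance UpperSet.instFinite (α : Type*) [LE α] [Finite α] : Finite (UpperSet α) :=
  Finite.of_injective (fun x : UpperSet α => (x : Set α)) SetLike.coe_injective

/-- The sets whose total weight reaches the threshold `θ`. -/
def thresholdRule (b : V → unitInterval) (θ : unitInterval) : UpperSet (Finset V) where
  carrier := {X | (θ : ℝ) ≤ ∑ u ∈ X, (b u : ℝ)}
  upper' _ _ h hX := le_trans (b := _) hX
    (Finset.sum_le_sum_of_subset_of_nonneg h fun u _ _ => (b u).2.1)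

/-- The sets that contain the chosen node, if there is one. -/
def liveRule (p : Option V) : UpperSet (Finset V) where
  carrier := {X | ∃ u ∈ X, p = some u}
  upper' _ _ h := fun ⟨u, hu, hp⟩ => ⟨u, h hu, hp⟩

theorem mem_thresholdRule {b : V → unitInterval} {θ : unitInterval} {X : Finset V} :
    X ∈ thresholdRule b θ ↔ (θ : ℝ) ≤ ∑ u ∈ X, (b u : ℝ) := Iff.rfl

theorem mem_liveRule {p : Option V} {X : Finset V} :
    X ∈ liveRule p ↔ ∃ u ∈ X, p = some u := Iff.rfl

instance Option.instMeasurableSpaceTop : MeasurableSpace (Option V) := ⊤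

instance Option.instDiscreteMeasurableSpaceTop : DiscreteMeasurableSpace (Option V) :=
  ⟨fun _ => trivial⟩

/-- The law that chooses `u` with probability `b u` and nothing with the remaining probability. -/
noncomputable def liveMeasure [Fintype V] (b : V → unitInterval) : Measure (Option V) :=
  ENNReal.ofReal (1 - ∑ u, (b u : ℝ)) • Measure.dirac none +
    ∑ u, ENNReal.ofReal (b u) • Measure.dirac (some u)

theorem isProbabilityMeasure_liveMeasure [Fintype V] {b : V → unitInterval} (hb : ∑ u, (b u : ℝ) ≤ 1) :
    IsProbabilityMeasure (liveMeasure b) := by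
  constructor
  simp only [liveMeasure, Measure.add_apply, Measure.smul_apply, Measure.finsetSum_apply,
    measure_univ, smul_eq_mul, mul_one]
  rw [← ENNReal.ofReal_sum_of_nonneg fun u _ => (b u).2.1,
    ← ENNReal.ofReal_add (sub_nonneg.2 hb) (Finset.sum_nonneg fun u _ => (b u).2.1)]
  simp

theorem liveMeasure_liveRule [Fintype V] (b : V → unitInterval) (X : Finset V) :
    (liveMeasure b).map liveRule {x | X ∈ x} = ENNReal.ofReal (∑ u ∈ X, (b u : ℝ)) := by
  classical
  rw [Measure.map_apply .of_discrete .of_discrete,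
    ENNReal.ofReal_sum_of_nonneg fun u _ => (b u).2.1]
  simp [liveMeasure, mem_liveRule, Set.indicator_apply]

theorem measurableSet_mem_thresholdRule (b : V → unitInterval) (X : Finset V) :
    MeasurableSet {θ | X ∈ thresholdRule b θ} :=
  measurableSet_le measurable_subtype_coe measurable_const

theorem measurable_thresholdRule [Fintype V] (b : V → unitInterval) : Measurable (thresholdRule b) := by
  refine measurable_to_countable' fun x => ?_
  have : thresholdRule b ⁻¹' {x} = ⋂ X : Finset V, {θ | X ∈ thresholdRule b θ ↔ X ∈ x} := by
    ext θ
    simp [SetLike.ext_iff]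
  rw [this]
  exact MeasurableSet.iInter fun X => (measurableSet_mem_thresholdRule b X).iff (.const _)

/-- Matches `liveMeasure_liveRule`. The bound `hb` makes the weight of `X` a point of the unit
interval, so that a uniform threshold lies below it with exactly that probability. -/
theorem volume_thresholdRule [Fintype V] {b : V → unitInterval} (hb : ∑ u, (b u : ℝ) ≤ 1) (X : Finset V) :
    (volume : Measure unitInterval).map (thresholdRule b) {x | X ∈ x} =
      ENNReal.ofReal (∑ u ∈ X, (b u : ℝ)) := by
  have h0 : 0 ≤ ∑ u ∈ X, (b u : ℝ) := Finset.sum_nonneg fun u _ => (b u).2.1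
  have h1 : ∑ u ∈ X, (b u : ℝ) ≤ 1 :=
    (Finset.sum_le_univ_sum_of_nonneg fun u => (b u).2.1).trans hb
  rw [Measure.map_apply (measurable_thresholdRule b) .of_discrete]
  exact unitInterval.volume_Iic ⟨_, h0, h1⟩

end Rules

/-! ### The influence function -/

namespace LTMInstance

variable {V : Type*} [Fintype V] [DecidableEq V] (I : LTMInstance V)

/-- The meetings along edges given by the coins. -/
def meets (coin : ℕ × V × V → Bool) (t : ℕ) (u v : V) : Prop :=
  I.graph.Adj u v ∧ coin (t, u, v) = true

/-- The two diffusions differ only in meetings with nodes that are already active. These cannot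
change who is active, so effective sets need to be compared only at inactive nodes. -/
theorem state_active_eq_ruleState (S : Finset V) (ω : LTMOutcome V) (t : ℕ) :
    (I.state S ω t).active =
        (ruleState (I.meets ω.2) (fun v => thresholdRule (I.b · v) (ω.1 v)) S t).active ∧
      ∀ v ∉ (I.state S ω t).active, (I.state S ω t).effective v =
        (ruleState (I.meets ω.2) (fun v => thresholdRule (I.b · v) (ω.1 v)) S t).effective v := by
  induction t with
  | zero => exact ⟨rfl, fun _ _ => rfl⟩
  | succ t ih =>
    obtain ⟨iha, ihe⟩ := ih
    set R := ruleState (I.meets ω.2) (fun v => thresholdRule (I.b · v) (ω.1 v)) S with hR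
    have he : ∀ v ∉ (I.state S ω t).active,
        (I.state S ω (t + 1)).effective v = (R (t + 1)).effective v := by
      intro v hv
      ext u
      rw [hR, mem_ruleState_effective_succ, ← hR, ← ihe v hv, ← iha]
      simp only [state, step, meets, Finset.mem_union, Finset.mem_filter, Finset.mem_univ,
        true_and]
      tauto
    have ha : ∀ v, v ∈ (I.state S ω (t + 1)).active ↔ v ∈ (I.state S ω t).active ∨
        (ω.1 v : ℝ) ≤ ∑ u ∈ (I.state S ω (t + 1)).effective v, (I.b u v : ℝ) := by
      intro v
      simp [state, step]
    refine ⟨Finset.ext fun v => ?_, fun v hv => he v fun h => hv ((ha v).2 (.inl h))⟩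
    rw [ha, hR, mem_ruleState_active_succ, ← hR, ← iha, mem_thresholdRule]
    by_cases hv : v ∈ (I.state S ω t).active
    · simp [hv]
    · rw [he v hv]

/-- For given coins, threshold rules and live-edge rules lead to the same expected spread. -/
theorem lintegral_threshold_eq_live (c : ℕ → V → V → Prop) (S : Finset V) (τ : ℕ) :
    ∫⁻ θ : V → unitInterval,
        ((ruleState c (fun v => thresholdRule (I.b · v) (θ v)) S τ).active.card : ENNReal)
        ∂Measure.pi (fun _ => volume) =
      ∫⁻ p : V → Option V, ((ruleState c (fun v => liveRule (p v)) S τ).active.card : ENNReal)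
        ∂Measure.pi (fun v => liveMeasure (I.b · v)) := by
  have hp : ∀ v, IsProbabilityMeasure (liveMeasure (I.b · v)) := fun v =>
    isProbabilityMeasure_liveMeasure (I.sum_b_le_one v)
  have hlive : Measurable (liveRule : Option V → UpperSet (Finset V)) := .of_discrete
  have hthr := fun v => measurable_thresholdRule (I.b · v)
  have hpμ : ∀ v, IsProbabilityMeasure
      ((volume : Measure unitInterval).map (thresholdRule (I.b · v))) := fun v =>
    Measure.isProbabilityMeasure_map (hthr v).aemeasurable
  have hpν : ∀ v, IsProbabilityMeasure ((liveMeasure (I.b · v)).map liveRule) := fun v =>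
    Measure.isProbabilityMeasure_map hlive.aemeasurable
  let g : (V → UpperSet (Finset V)) → ENNReal := fun r => ((ruleState c r S τ).active.card : ENNReal)
  have hg : Measurable g := .of_discrete
  have key : ∫⁻ r, g r ∂Measure.pi (fun v => volume.map (thresholdRule (I.b · v))) =
      ∫⁻ r, g r ∂Measure.pi (fun v => (liveMeasure (I.b · v)).map liveRule) := by
    refine lintegral_pi_congr _ _ hg fun v r => ?_
    refine lintegral_upperSet_congr _ _
      (fun X => (volume_thresholdRule (I.sum_b_le_one v) X).trans
        (liveMeasure_liveRule (I.b · v) X).symm)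
      (monotone_ruleState_effective c (Function.update r v ⊤) S v) τ _ fun x y hxy => ?_
    simp only [g, ruleState_update_congr c r S v x y hxy]
  rw [← Measure.pi_map_pi fun v => (hthr v).aemeasurable,
    ← Measure.pi_map_pi fun v => hlive.aemeasurable, lintegral_map hg, lintegral_map hg] at key
  · exact key
  · exact measurable_pi_lambda _ fun v => hlive.comp (measurable_pi_apply v)
  · exact measurable_pi_lambda _ fun v => (hthr v).comp (measurable_pi_apply v)

/-- The expected spread for given coins. -/
noncomputable def coinInfluence (τ : ℕ) (S : Finset V) (coin : ℕ × V × V → Bool) : ℝ :=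
  ∫ p : V → Option V,
    ((ruleState (I.meets coin) (fun v => liveRule (p v)) S τ).active.card : ℝ)
    ∂Measure.pi (fun v => liveMeasure (I.b · v))

theorem integral_card_active_eq_coinInfluence (τ : ℕ) (S : Finset V) (coin : ℕ × V × V → Bool) :
    ∫ θ : V → unitInterval, ((I.state S (θ, coin) τ).active.card : ℝ)
      ∂Measure.pi (fun _ => volume) = I.coinInfluence τ S coin := by
  have hmeas : Measurable fun θ : V → unitInterval =>
      ((ruleState (I.meets coin) (fun v => thresholdRule (I.b · v) (θ v)) S τ).active.card : ℝ) :=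
    (Measurable.of_discrete (f := fun r : V → UpperSet (Finset V) =>
      ((ruleState (I.meets coin) r S τ).active.card : ℝ))).comp
      (measurable_pi_lambda _ fun v =>
        (measurable_thresholdRule (I.b · v)).comp (measurable_pi_apply v))
  simp only [(I.state_active_eq_ruleState S _ τ).1]
  rw [coinInfluence, integral_eq_lintegral_of_nonneg_ae (.of_forall fun _ => Nat.cast_nonneg _)
      hmeas.aestronglyMeasurable,
    integral_eq_lintegral_of_nonneg_ae (.of_forall fun _ => Nat.cast_nonneg _)
      Measurable.of_discrete.aestronglyMeasurable]
  simp only [ENNReal.ofReal_natCast]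
  rw [I.lintegral_threshold_eq_live]

theorem coinInfluence_submodular (τ : ℕ) (coin : ℕ × V × V → Bool) :
    Monotone (I.coinInfluence τ · coin) ∧ IsSubmodular (I.coinInfluence τ · coin) := by
  have hp : ∀ v, IsProbabilityMeasure (liveMeasure (I.b · v)) := fun v =>
    isProbabilityMeasure_liveMeasure (I.sum_b_le_one v)
  have h := fun p : V → Option V => Finset.card_submodular_of_union
    (F := fun S => (ruleState (I.meets coin) (fun v => liveRule (p v)) S τ).active)
    fun S T => (ruleState_union _ _ S T (fun v X Y => by
      simp only [mem_liveRule, Finset.mem_union, or_and_right, exists_or]) τ).1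
  have hint : ∀ S, Integrable (fun p : V → Option V =>
      ((ruleState (I.meets coin) (fun v => liveRule (p v)) S τ).active.card : ℝ))
      (Measure.pi (fun v => liveMeasure (I.b · v))) := fun S => .of_finite
  refine ⟨fun S T hST => integral_mono (hint S) (hint T) fun p => (h p).1 hST,
    fun S T hST w hw => ?_⟩
  simp only [coinInfluence]
  rw [← integral_sub (hint _) (hint _), ← integral_sub (hint _) (hint _)]
  exact integral_mono ((hint _).sub (hint _)) ((hint _).sub (hint _))
    fun p => (h p).2 S T hST w hw

theorem influence_eq_integral_coinInfluence (τ : ℕ) (S : Finset V) :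
    I.influence τ S = ∫ coin, I.coinInfluence τ S coin ∂Measure.infinitePi
      fun e : ℕ × V × V => bernoulliMeasure true false (I.m e.2.1 e.2.2) := by
  simp only [influence, ← integral_card_active_eq_coinInfluence]
  -- The coins become the outer variable, since thresholds are traded for choices only with the
  -- coins fixed.
  exact integral_prod_symm _ (I.integrable_card_active τ S)

theorem integrable_coinInfluence (τ : ℕ) (S : Finset V) :
    Integrable (I.coinInfluence τ S) (Measure.infinitePi
      fun e : ℕ × V × V => bernoulliMeasure true false (I.m e.2.1 e.2.2)) := by
  have h := (I.integrable_card_active τ S).integral_prod_right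
  simpa only [integral_card_active_eq_coinInfluence] using h

theorem monotone_influence (τ : ℕ) : Monotone (I.influence τ) := fun S T hST => by
  simp only [influence_eq_integral_coinInfluence]
  exact integral_mono (I.integrable_coinInfluence τ S) (I.integrable_coinInfluence τ T)
    fun coin => (I.coinInfluence_submodular τ coin).1 hST

theorem isSubmodular_influence (τ : ℕ) : IsSubmodular (I.influence τ) := fun S T hST w hw => by
  have hint := I.integrable_coinInfluence τ
  simp only [influence_eq_integral_coinInfluence]
  rw [← integral_sub (hint _) (hint _), ← integral_sub (hint _) (hint _)]
  exact integral_mono ((hint _).sub (hint _)) ((hint _).sub (hint _))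
    fun coin => (I.coinInfluence_submodular τ coin).2 S T hST w hw

end LTMInstance

theorem mainTheorem1 {V : Type*} [Fintype V] [DecidableEq V] (I : LTMInstance V) (τ : ℕ)
    (hτ : 1 ≤ τ) :
    Monotone (I.influence τ) ∧
    IsSubmodular (I.influence τ) ∧
    ∀ k : ℕ, k ≤ Fintype.card V →
      (∃ S, GreedyOutput (I.influence τ) k S) ∧
      ∀ S, GreedyOutput (I.influence τ) k S →
        S.card = k ∧
        ∀ T : Finset V, T.card ≤ k →
          (1 - 1 / Real.exp 1) * I.influence τ T ≤ I.influence τ S :=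
  ⟨I.monotone_influence τ, I.isSubmodular_influence τ, fun _ hk =>
    ⟨GreedyOutput.exists _ hk, fun _ hS => ⟨hS.card_eq, fun _ hT =>
      hS.guarantee (I.isSubmodular_influence τ) (I.monotone_influence τ)
        (integral_nonneg fun _ => Nat.cast_nonneg _) hT⟩⟩⟩
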